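/- Let $d,s\ge 1$, let $G\subset\mathbb{R}^d$ be a bounded, Borel measurable set, and let $\pi$ be a probability measure on $(G,\mathcal{B}(G))$. Let $\mathscr{B}=\{(-\infty,y)\cap G : y\in\mathbb{R}^d\}$, where $(-\infty,y)=\prod_{j=1}^d(-\infty,y_j)$, be the set of anchored boxes intersected with $G$. For points $x_1,\dots,x_n\in G$ (repetitions allowed) put $$D^*_{\mathscr{B},\pi}(x_1,\dots,x_n)=\sup_{A\in\mathscr{B}}\left|\frac1n\sum_{i=1}^n 1_{x_i\in A}-\pi(A)\right|.$$ Let $K$ be a transition kernel on $(G,\mathcal{B}(G))$ and let $\varphi\colon G\times[0,1]^s\to G$ be an update function of $K$, that is, $\varphi$ is measurable and $K(x,A)=\lambda_s(\{u\in[0,1]^s:\varphi(x;u)\in A\})$ for all $x\in G$ and $A\in\mathcal{B}(G)$, where $\lambda_s$ is the Lebesgue measure. Assume that $\varphi$ satisfies the anywhere-to-anywhere condition: for all $x,y\in G$ there is a $u\in[0,1]^s$ with $\varphi(x;u)=y$. Let $\psi\colon[0,1]^s\to G$ be any surjective function. Then for every integer $n\ge 1$ there exists a driver sequence $u_0,u_1,\dots,u_{n-1}\in[0,1]^s$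 such that the points given by $x_1=\psi(u_0)$ and $x_{i+1}=\varphi(x_i;u_i)$ for $i=1,\dots,n-1$ satisfy $$D^*_{\mathscr{B},\pi}(x_1,\dots,x_n)\le 63\sqrt d\,\frac{(2+\log_2 n)^{(3d+1)/2}}{n}.$$ -/

import Mathlib

open MeasureTheory ProbabilityTheory

/-- The unit cube `[0,1]^s`. Its `volume` (product of the Lebesgue measures on `[0,1]`) is the
uniform distribution on `[0,1]^s`. -/
abbrev UnitCube (s : ℕ) : Type := Fin s → unitInterval

/-- `φ : G × [0,1]^s → G` is an update function of the transition kernel `K`: it is measurable, and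
`K(x, A)` is the Lebesgue measure of `{u ∈ [0,1]^s | φ(x; u) ∈ A}`, for all `x ∈ G` and all
measurable `A ⊆ G`. -/
def IsUpdateFunction {G : Type*} [MeasurableSpace G] {s : ℕ} (K : Kernel G G)
    (φ : G → UnitCube s → G) : Prop :=
  Measurable (fun p : G × UnitCube s => φ p.1 p.2) ∧
    ∀ (x : G) (A : Set G), MeasurableSet A → K x A = volume {u : UnitCube s | φ x u ∈ A}

/-- Every state can be reached from every state in one step. -/
def AnywhereToAnywhere {G : Type*} {s : ℕ} (φ : G → UnitCube s → G) : Prop :=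
  ∀ x y : G, ∃ u : UnitCube s, φ x u = y

/-- The state produced from the driver sequence `u_0, …, u_{n-1}` with index `i`, counted from `0`:
the initial state is `ψ(u_0)`, and the state with index `i + 1` is `φ(x; u_{i+1})`, where `x` is the
state with index `i`. -/
def drivenState {G : Type*} {s : ℕ} (φ : G → UnitCube s → G) (ψ : UnitCube s → G) {n : ℕ}
    (u : Fin n → UnitCube s) : (i : ℕ) → i < n → G
  | 0, h => ψ (u ⟨0, h⟩)
  | i + 1, h => φ (drivenState φ ψ u i (Nat.lt_of_succ_lt h)) (u ⟨i + 1, h⟩)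

/-- The `n` points `x_1 = ψ(u_0)`, `x_{i+1} = φ(x_i; u_i)` (`1 ≤ i ≤ n - 1`), where `x_{i+1}` is the
value at the index `i : Fin n`. -/
def drivenPoints {G : Type*} {s : ℕ} (φ : G → UnitCube s → G) (ψ : UnitCube s → G) {n : ℕ}
    (u : Fin n → UnitCube s) : Fin n → G :=
  fun i => drivenState φ ψ u i.1 i.2

/-- The star-discrepancy `sup_{A ∈ 𝒜} |(1/n) ∑_i 1_{x_i ∈ A} - π(A)|`. For a probability measure `π`
each of these numbers is at most `1`, so that the supremum of reals is a genuine one. -/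
noncomputable def starDiscrepancy {G : Type*} [MeasurableSpace G] (𝒜 : Set (Set G))
    (π : Measure G) {n : ℕ} (x : Fin n → G) : ℝ :=
  ⨆ A : 𝒜, |(1 / (n : ℝ)) * ∑ i, (A : Set G).indicator (fun _ => (1 : ℝ)) (x i) - π.real (A : Set G)|

/-- The sets `(-∞, y) ∩ G` with `y ∈ ℝ^d`, where `(-∞, y) = ∏_j (-∞, y_j)`, as subsets of `G`. -/
def anchoredBoxes {d : ℕ} (G : Set (Fin d → ℝ)) : Set (Set G) :=
  {A | ∃ y : Fin d → ℝ, A = {g : G | ∀ j, (g : Fin d → ℝ) j < y j}}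

/-! Since `ψ` is onto and every state leads to every state in one step, each `n`-tuple of points of
`G` is a trajectory (`drivenPoints_surjective`). It remains to find `n` points of `G` whose counts
in anchored boxes are close to `n π`.

Each axis is cut into at most `2n + 1` intervals adapted to the `1 / n`-quantiles of the marginal of
`π`; replacing a box by a union of grid cells then costs at most `1` per axis in `n π`
(`quantileCell_ne_or_measureReal_le`). The weights `n π(cell)` must be rounded to integers with
small error on all grid boxes at once (`exists_nat_rounding_of_grid`). Binary expansion and tensor
products write the indicator of "cell `c` lies in box `a`" as an inner product of vectors of squared
norm at most `k ^ d`, where `2 ^ k` is the grid size per axis. So the rounding is a vector balancing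
problem with a Gaussian tail (`exists_signs_abs_inner_le`).

The balancing is a derandomised Gram–Schmidt walk. A weighted sum of exponential moments, corrected
by `walkFactor`, is affine along each step, hence one of the two directions does not increase it.
The correction is designed so that the potential also does not increase when a coordinate freezes at
`±1` (`exp_le_walkFactor`, `walkFactor_mono`). -/

/-! ### One-variable estimates for the pivot factor. -/

theorem le_tangent_of_antitone_deriv {f f' : ℝ → ℝ} (hf : ∀ x, HasDerivAt f (f' x) x)
    (hf' : Antitone f') (x y : ℝ) : f y ≤ f x + f' x * (y - x) := by
  have hcont : Continuous f := continuous_iff_continuousAt.2 fun z => (hf z).continuousAt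
  rcases lt_trichotomy x y with h | rfl | h
  · obtain ⟨c, hc, he⟩ := exists_hasDerivAt_eq_slope f f' h hcont.continuousOn fun z _ => hf z
    rw [eq_div_iff (by linarith)] at he
    have := mul_le_mul_of_nonneg_right (hf' hc.1.le) (sub_nonneg.2 h.le)
    linarith
  · simp
  · obtain ⟨c, hc, he⟩ := exists_hasDerivAt_eq_slope f f' h hcont.continuousOn fun z _ => hf z
    rw [eq_div_iff (by linarith)] at he
    have := mul_le_mul_of_nonneg_right (hf' hc.2.le) (sub_nonneg.2 h.le)
    linarith

theorem cosh_add_mul_sinh_pos {t : ℝ} (ht : |t| ≤ 1) (a : ℝ) :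
    0 < Real.cosh a + t * Real.sinh a := by
  have h := abs_le.1 ht
  rw [Real.cosh_eq, Real.sinh_eq]
  have h1 := Real.exp_pos a
  have h2 := Real.exp_pos (-a)
  rcases le_or_gt t 0 with h0 | h0 <;> nlinarith

/-- The moment generating function at `a` of the centred `±1`-valued variable with mean `t`,
divided by that of a standard Gaussian. -/
noncomputable def pivotFactor (a t : ℝ) : ℝ :=
  Real.exp (-(a ^ 2 / 2) - a * t) * (Real.cosh a + t * Real.sinh a)

theorem pivotFactor_pos {t : ℝ} (ht : |t| ≤ 1) (a : ℝ) : 0 < pivotFactor a t :=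
  mul_pos (Real.exp_pos _) (cosh_add_mul_sinh_pos ht a)

/-- The logarithm `k` of the factor has `k' 0 = 0` and second derivative in `[-1, 0]`. So it is
concave, `k' a` lies between `0` and `-a`, and the tangent at `a` bounds `k b`. -/
theorem pivotFactor_le_mul_exp {t : ℝ} (ht : |t| ≤ 1) (a b : ℝ) :
    pivotFactor b t ≤ pivotFactor a t * Real.exp (max 0 (-(b - a) * a)) := by
  set D : ℝ → ℝ := fun x => Real.cosh x + t * Real.sinh x with hD
  set r : ℝ → ℝ := fun x => (Real.sinh x + t * Real.cosh x) / D x with hr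
  have hDpos : ∀ x, 0 < D x := cosh_add_mul_sinh_pos ht
  have hD' : ∀ x, HasDerivAt D (Real.sinh x + t * Real.cosh x) x := fun x =>
    (Real.hasDerivAt_cosh x).add ((Real.hasDerivAt_sinh x).const_mul t)
  have hN' : ∀ x, HasDerivAt (fun x => Real.sinh x + t * Real.cosh x) (D x) x := fun x =>
    (Real.hasDerivAt_sinh x).add ((Real.hasDerivAt_cosh x).const_mul t)
  have hr' : ∀ x, HasDerivAt r ((1 - t ^ 2) / D x ^ 2) x := fun x => by
    refine ((hN' x).div (hD' x) (hDpos x).ne').congr_deriv ?_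
    congr 1
    linear_combination (1 - t ^ 2) * Real.cosh_sq_sub_sinh_sq x
  have ht2 : 0 ≤ 1 - t ^ 2 := by
    have := abs_le.1 ht
    nlinarith
  have hrmono : Monotone r := monotone_of_hasDerivAt_nonneg hr' fun x => by positivity
  have hrle : ∀ x, (1 - t ^ 2) / D x ^ 2 ≤ 1 := fun x => by
    rw [div_le_one (pow_pos (hDpos x) 2)]
    simp only [hD]
    nlinarith [sq_nonneg (Real.sinh x + t * Real.cosh x), Real.cosh_sq_sub_sinh_sq x]
  set k' : ℝ → ℝ := fun x => r x - t - x with hk'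
  have hanti : Antitone k' := by
    refine antitone_of_hasDerivAt_nonpos
      (f' := fun x => (1 - t ^ 2) / D x ^ 2 - 1) (fun x => ?_) fun x => ?_
    · exact ((hr' x).sub_const t).sub (hasDerivAt_id x)
    · have := hrle x
      simpa using this
  set k : ℝ → ℝ := fun x => Real.log (D x) - t * x - x ^ 2 / 2 with hk
  have hkd : ∀ x, HasDerivAt k (k' x) x := fun x => by
    have h1 := (((hD' x).log (hDpos x).ne').sub ((hasDerivAt_id x).const_mul t)).sub
      (((hasDerivAt_id x).pow 2).div_const 2)
    refine h1.congr_deriv ?_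
    simp [hk', hr]
  have hr0 : r 0 = t := by simp [hr, hD]
  have htan := le_tangent_of_antitone_deriv hkd hanti a b
  have hle : k b ≤ k a + max 0 (-(b - a) * a) := by
    rcases le_total 0 a with ha | ha
    · have h1 : k' a ≤ 0 := by simpa [hk', hr0] using hanti ha
      have h2 : -a ≤ k' a := by
        have := hrmono ha
        simp only [hk']; linarith
      rcases le_total a b with hb | hb
      · nlinarith [le_max_left 0 (-(b - a) * a)]
      · nlinarith [le_max_right 0 (-(b - a) * a)]
    · have h1 : 0 ≤ k' a := by simpa [hk', hr0] using hanti ha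
      have h2 : k' a ≤ -a := by
        have := hrmono ha
        simp only [hk']; linarith
      rcases le_total a b with hb | hb
      · nlinarith [le_max_right 0 (-(b - a) * a)]
      · nlinarith [le_max_left 0 (-(b - a) * a)]
  have hexp : ∀ x, pivotFactor x t = Real.exp (k x) := fun x => by
    rw [show k x = (-(x ^ 2 / 2) - x * t) + Real.log (D x) by simp only [hk]; ring, Real.exp_add,
      Real.exp_log (hDpos x)]
    rfl
  rw [hexp, hexp, ← Real.exp_add]
  exact Real.exp_le_exp.2 hle

theorem pivotFactor_zero (t : ℝ) : pivotFactor 0 t = 1 := by simp [pivotFactor]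

theorem pivotFactor_le_one {t : ℝ} (ht : |t| ≤ 1) (a : ℝ) : pivotFactor a t ≤ 1 := by
  simpa [pivotFactor_zero] using pivotFactor_le_mul_exp ht 0 a

theorem pivotFactor_of_sq_eq_one {t : ℝ} (ht : t = 1 ∨ t = -1) (a : ℝ) :
    pivotFactor a t = Real.exp (-(a ^ 2 / 2)) := by
  rcases ht with rfl | rfl
  · rw [pivotFactor, one_mul, Real.cosh_add_sinh, ← Real.exp_add]
    congr 1; ring
  · rw [pivotFactor, neg_one_mul, ← sub_eq_add_neg, Real.cosh_sub_sinh, ← Real.exp_add]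
    congr 1; ring

/-! ### Orthogonal projections and the change of the potential under freezing. -/

section Projection

variable {E : Type*} [NormedAddCommGroup E] [InnerProductSpace ℝ E] [FiniteDimensional ℝ E]

theorem norm_sq_starProjection_le_of_le {U V : Submodule ℝ E} (h : U ≤ V) (θ : E) :
    ‖U.starProjection θ‖ ^ 2 ≤ ‖V.starProjection θ‖ ^ 2 := by
  have : U.starProjection θ = U.starProjection (V.starProjection θ) := by
    have := Submodule.starProjection_comp_starProjection_of_le h
    exact (DFunLike.congr_fun this θ).symm
  rw [this]
  gcongr
  exact Submodule.norm_starProjection_apply_le _ _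

/-- Only the component of `θ` in the orthogonal complement of `U` inside `V` pairs with `z`; this is
Cauchy–Schwarz for it. -/
theorem inner_sq_le_mul_norm_sq_starProjection_sub {U V : Submodule ℝ E} (h : U ≤ V) (θ : E)
    {z : E} (hzV : z ∈ V) (hzU : z ∈ Uᗮ) :
    inner ℝ θ z ^ 2 ≤ ‖z‖ ^ 2 * (‖V.starProjection θ‖ ^ 2 - ‖U.starProjection θ‖ ^ 2) := by
  set p := V.starProjection θ with hp
  have hU : U.starProjection θ = U.starProjection p := by
    have := Submodule.starProjection_comp_starProjection_of_le h
    exact (DFunLike.congr_fun this θ).symm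
  set q := U.starProjection p with hq
  have h1 : inner ℝ θ z = inner ℝ (p - q) z := by
    have e1 := Submodule.starProjection_inner_eq_zero (K := V) θ z hzV
    have e2 : inner ℝ q z = 0 :=
      (Submodule.mem_orthogonal U z).1 hzU q (Submodule.starProjection_apply_mem _ _)
    rw [inner_sub_left] at e1 ⊢
    linarith
  have h2 : ‖p - q‖ ^ 2 = ‖p‖ ^ 2 - ‖q‖ ^ 2 := by
    have e1 := Submodule.starProjection_inner_eq_zero (K := U) p q
      (Submodule.starProjection_apply_mem _ _)
    have e2 : inner ℝ (p - q) q = 0 := e1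
    have e3 : ‖p‖ ^ 2 = ‖(p - q) + q‖ ^ 2 := by simp
    rw [e3, norm_add_sq_real, e2]
    ring
  rw [hU, h1, ← h2, mul_comm, ← mul_pow]
  have := abs_real_inner_le_norm (p - q) z
  exact sq_le_sq' (by linarith [abs_le.1 this]) (le_of_abs_le this)

theorem norm_sub_starProjection_le (W : Submodule ℝ E) (v : E) : ‖v - W.starProjection v‖ ≤ ‖v‖ := by
  rw [← Submodule.starProjection_orthogonal_val]
  exact Submodule.norm_starProjection_apply_le _ _

/-- The part of the potential of the Gram–Schmidt walk that depends on the pivot `v`, its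
coordinate `t`, and the span `W` of the other active vectors. -/
noncomputable def walkFactor (W : Submodule ℝ E) (v θ : E) (t : ℝ) : ℝ :=
  Real.exp (‖(W ⊔ Submodule.span ℝ {v}).starProjection θ‖ ^ 2 / 2) *
    pivotFactor (inner ℝ θ (v - W.starProjection v)) t

theorem walkFactor_le (W : Submodule ℝ E) (v θ : E) {t : ℝ} (ht : |t| ≤ 1) :
    walkFactor W v θ t ≤ Real.exp (‖(W ⊔ Submodule.span ℝ {v}).starProjection θ‖ ^ 2 / 2) :=
  mul_le_of_le_one_right (Real.exp_pos _).le (pivotFactor_le_one ht _)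

/-- Used when the pivot freezes: the loss `exp (-(a ^ 2 / 2))` is paid by the drop of the projected
norm from `W ⊔ span {v}` to `W`. -/
theorem exp_le_walkFactor (W : Submodule ℝ E) {v : E} (hv : ‖v‖ ≤ 1) (θ : E) {t : ℝ}
    (ht : t = 1 ∨ t = -1) :
    Real.exp (‖W.starProjection θ‖ ^ 2 / 2) ≤ walkFactor W v θ t := by
  rw [walkFactor, pivotFactor_of_sq_eq_one ht, ← Real.exp_add]
  refine Real.exp_le_exp.2 ?_
  have hU : W ≤ W ⊔ Submodule.span ℝ {v} := le_sup_left
  have hzV : v - W.starProjection v ∈ W ⊔ Submodule.span ℝ {v} :=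
    Submodule.sub_mem _ (Submodule.mem_sup_right (Submodule.mem_span_singleton_self v))
      (hU (Submodule.starProjection_apply_mem _ _))
  have h1 := inner_sq_le_mul_norm_sq_starProjection_sub hU θ hzV
    (Submodule.sub_starProjection_mem_orthogonal v)
  have h2 := norm_sq_starProjection_le_of_le hU θ
  have h3 : ‖v - W.starProjection v‖ ^ 2 ≤ 1 :=
    pow_le_one₀ (norm_nonneg _) ((norm_sub_starProjection_le W v).trans hv)
  nlinarith

/-- Used when a vector other than the pivot freezes. The residual of `v` grows from `w` to `w + g`,
and the possible gain in `pivotFactor` is covered by the loss in projected norm. -/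
theorem walkFactor_mono {W W' : Submodule ℝ E} (hW : W' ≤ W) {v : E} (hv : ‖v‖ ≤ 1) (θ : E)
    {t : ℝ} (ht : |t| ≤ 1) : walkFactor W' v θ t ≤ walkFactor W v θ t := by
  set U := W ⊔ Submodule.span ℝ {v}
  set U' := W' ⊔ Submodule.span ℝ {v}
  have hUU : U' ≤ U := sup_le_sup_right hW _
  set w := v - W.starProjection v with hw
  set g := W.starProjection v - W'.starProjection v with hg
  have hwg : v - W'.starProjection v = w + g := by rw [hw, hg]; abel
  have hgW : g ∈ W := Submodule.sub_mem _ (Submodule.starProjection_apply_mem _ _)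
    (hW (Submodule.starProjection_apply_mem _ _))
  have hwW : w ∈ Wᗮ := Submodule.sub_starProjection_mem_orthogonal v
  have hwW' : w ∈ W'ᗮ := Submodule.orthogonal_le hW hwW
  have hwgW' : w + g ∈ W'ᗮ := hwg ▸ Submodule.sub_starProjection_mem_orthogonal v
  have hgW' : g ∈ W'ᗮ := by
    have := Submodule.sub_mem _ hwgW' hwW'
    simpa using this
  have hwU : w ∈ U := Submodule.sub_mem _
    (Submodule.mem_sup_right (Submodule.mem_span_singleton_self v))
    (Submodule.mem_sup_left (Submodule.starProjection_apply_mem _ _))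
  have hgU : g ∈ U := Submodule.mem_sup_left hgW
  have horth : inner ℝ g w = 0 := (Submodule.mem_orthogonal W w).1 hwW g hgW
  set s := ‖w‖ ^ 2 with hs
  set γ := ‖g‖ ^ 2 with hγ
  have hsum : s + γ ≤ 1 := by
    have h1 : ‖w + g‖ ^ 2 = s + γ := by
      rw [norm_add_sq_real, real_inner_comm, horth]; ring
    rw [← h1, ← hwg]
    exact pow_le_one₀ (norm_nonneg _) ((norm_sub_starProjection_le W' v).trans hv)
  -- The combination of `w` and `g` orthogonal to `w + g`: a direction lost in passing from `U` to
  -- `U'`.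
  set z := γ • w - s • g with hz
  have hzU : z ∈ U := Submodule.sub_mem _ (Submodule.smul_mem _ _ hwU) (Submodule.smul_mem _ _ hgU)
  have hzW' : z ∈ W'ᗮ :=
    Submodule.sub_mem _ (Submodule.smul_mem _ _ hwW') (Submodule.smul_mem _ _ hgW')
  have hww : inner ℝ w w = s := real_inner_self_eq_norm_sq w
  have hgg : inner ℝ g g = γ := real_inner_self_eq_norm_sq g
  have hwg0 : inner ℝ w g = 0 := by rw [real_inner_comm, horth]
  have hvz : inner ℝ v z = 0 := by
    have e1 : v = (w + g) + W'.starProjection v := by rw [← hwg]; abel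
    have e2 : inner ℝ (W'.starProjection v) z = 0 :=
      (Submodule.mem_orthogonal W' z).1 hzW' _ (Submodule.starProjection_apply_mem _ _)
    rw [e1, inner_add_left, e2, hz]
    simp only [inner_add_left, inner_sub_right, inner_smul_right, hww, hgg, hwg0, horth]
    ring
  have hzU' : z ∈ U'ᗮ := by
    rw [← Submodule.inf_orthogonal]
    exact ⟨hzW', Submodule.mem_orthogonal_singleton_iff_inner_right.2 hvz⟩
  have hzn : ‖z‖ ^ 2 = s * γ * (s + γ) := by
    rw [← real_inner_self_eq_norm_sq, hz]
    simp only [inner_sub_left, inner_sub_right, inner_smul_left, inner_smul_right, hww, hgg, hwg0,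
      horth]
    simp
    ring
  set a := inner ℝ θ w with ha
  set b := inner ℝ θ g with hb
  have hθz : inner ℝ θ z = γ * a - s * b := by
    rw [hz, inner_sub_right, inner_smul_right, inner_smul_right]
  have hproj := inner_sq_le_mul_norm_sq_starProjection_sub hUU θ hzU hzU'
  have hmono := norm_sq_starProjection_le_of_le hUU θ
  have hpf := pivotFactor_le_mul_exp ht a (a + b)
  have hs0 : 0 ≤ s := sq_nonneg _
  have hγ0 : 0 ≤ γ := sq_nonneg _
  have ha2 : s = 0 → a = 0 := fun h => by
    have : w = 0 := by simpa [hs] using h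
    simp [ha, this]
  have hb2 : γ = 0 → b = 0 := fun h => by
    have : g = 0 := by simpa [hγ] using h
    simp [hb, this]
  have hkey : max 0 (-(a + b - a) * a) ≤
      ‖U.starProjection θ‖ ^ 2 / 2 - ‖U'.starProjection θ‖ ^ 2 / 2 := by
    refine max_le (by linarith) ?_
    rcases hs0.eq_or_lt with h | h
    · rw [ha2 h.symm]; linarith
    rcases hγ0.eq_or_lt with h' | h'
    · rw [hb2 h'.symm]; linarith
    rw [hθz, hzn] at hproj
    set Δ := ‖U.starProjection θ‖ ^ 2 - ‖U'.starProjection θ‖ ^ 2 with hΔ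
    have hΔ0 : 0 ≤ Δ := by linarith
    have hsγ : 0 < s * γ := mul_pos h h'
    have h1 : s * γ * (s + γ) * Δ ≤ s * γ * Δ := by
      have := mul_le_mul_of_nonneg_left hsum (mul_nonneg hsγ.le hΔ0)
      linarith
    -- Uses `(γ a - s b)² + 4 s γ a b = (γ a + s b)²`.
    have h2 : -(4 * (s * γ) * (a * b)) ≤ s * γ * Δ := by nlinarith [sq_nonneg (γ * a + s * b)]
    have h3 : -(4 * (a * b)) ≤ Δ := by
      refine le_of_mul_le_mul_left ?_ hsγ
      linarith
    have h4 : -(a * b) ≤ Δ / 2 := by linarith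
    have : ‖U.starProjection θ‖ ^ 2 / 2 - ‖U'.starProjection θ‖ ^ 2 / 2 = Δ / 2 := by
      rw [hΔ]; ring
    rw [this]
    linarith
  have hexp : Real.exp (max 0 (-(a + b - a) * a)) ≤
      Real.exp (‖U.starProjection θ‖ ^ 2 / 2) / Real.exp (‖U'.starProjection θ‖ ^ 2 / 2) := by
    rw [← Real.exp_sub]
    exact Real.exp_le_exp.2 hkey
  have e1 : inner ℝ θ (v - W'.starProjection v) = a + b := by rw [hwg, inner_add_right]
  calc walkFactor W' v θ t
      = Real.exp (‖U'.starProjection θ‖ ^ 2 / 2) * pivotFactor (a + b) t := by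
        rw [walkFactor, e1]
    _ ≤ Real.exp (‖U'.starProjection θ‖ ^ 2 / 2) * (pivotFactor a t *
          (Real.exp (‖U.starProjection θ‖ ^ 2 / 2) /
            Real.exp (‖U'.starProjection θ‖ ^ 2 / 2))) := by
        refine mul_le_mul_of_nonneg_left (hpf.trans ?_) (Real.exp_pos _).le
        exact mul_le_mul_of_nonneg_left hexp (pivotFactor_pos ht a).le
    _ = walkFactor W v θ t := by
        rw [mul_left_comm, mul_div_cancel₀ _ (Real.exp_ne_zero _), mul_comm]
        rfl

end Projection

/-! ### The derandomised Gram–Schmidt walk. -/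

section Walk

theorem exists_step_to_boundary {ι : Type*} {A : Finset ι} {p : ι} (hp : p ∈ A) (x u : ι → ℝ)
    (hx : ∀ i ∈ A, |x i| ≤ 1) (hu : u p ≠ 0) :
    ∃ δ : ℝ, 0 ≤ δ ∧ (∀ i ∈ A, |x i + δ * u i| ≤ 1) ∧
      ∃ i ∈ A, x i + δ * u i = 1 ∨ x i + δ * u i = -1 := by
  classical
  -- The time at which coordinate `i`, moving with velocity `u i`, reaches `±1`; the first such time
  -- is taken.
  set τ : ι → ℝ := fun i => (1 - x i * SignType.sign (u i)) / |u i| with hτ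
  obtain ⟨i, hi, hmin⟩ := (A.filter fun i => u i ≠ 0).exists_min_image τ
    ⟨p, Finset.mem_filter.2 ⟨hp, hu⟩⟩
  rw [Finset.mem_filter] at hi
  have h0 : ∀ j ∈ A, u j ≠ 0 → 0 ≤ τ j := fun j hj hj0 => by
    have := abs_le.1 (hx j hj)
    rcases hj0.lt_or_gt with h | h
    · simp only [hτ, sign_neg h, abs_of_neg h]
      exact div_nonneg (by simp; linarith) (by linarith)
    · simp only [hτ, sign_pos h, abs_of_pos h]
      exact div_nonneg (by simp; linarith) h.le
  refine ⟨τ i, h0 i hi.1 hi.2, fun j hj => ?_, i, hi.1, ?_⟩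
  · by_cases hj0 : u j = 0
    · simpa [hj0] using hx j hj
    have h1 := hmin j (Finset.mem_filter.2 ⟨hj, hj0⟩)
    have h2 := h0 i hi.1 hi.2
    have := abs_le.1 (hx j hj)
    have h3 : τ j = (1 - x j * SignType.sign (u j)) / |u j| := rfl
    rw [abs_le]
    rcases lt_or_gt_of_ne hj0 with h | h
    · rw [h3, sign_neg h, abs_of_neg h, le_div_iff₀ (by linarith)] at h1
      simp at h1
      constructor <;> nlinarith
    · rw [h3, sign_pos h, abs_of_pos h, le_div_iff₀ h] at h1
      simp at h1
      constructor <;> nlinarith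
  · have h3 : τ i = (1 - x i * SignType.sign (u i)) / |u i| := rfl
    rcases lt_or_gt_of_ne hi.2 with h | h
    · right
      rw [h3, sign_neg h, abs_of_neg h]
      have := hi.2
      field_simp
      simp
    · left
      rw [h3, sign_pos h, abs_of_pos h]
      have := hi.2
      field_simp
      simp

variable {ι κ : Type*} [Fintype ι] [DecidableEq ι]
variable {E : Type*} [NormedAddCommGroup E] [InnerProductSpace ℝ E] [FiniteDimensional ℝ E]

/-- The direction `u` moves the pivot at unit speed and moves the vector sum along the part of `v p`
orthogonal to the other active vectors. The resulting factor `exp (δ α)` cancels the `exp (-α t)` of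
`pivotFactor`, which leaves `cosh α + t sinh α`, affine in `δ`. Hence the sign of the slope `F`
tells which way to walk. -/
theorem exists_step_of_walk (v : ι → E) (S : Finset κ) (c : κ → ℝ) (θ : κ → E)
    {B : Finset ι} {p : ι} (hp : p ∉ B) {x : ι → ℝ} (hx : ∀ i, |x i| ≤ 1) :
    ∃ x' : ι → ℝ, (∀ i, |x' i| ≤ 1) ∧ (∀ i, i ∉ insert p B → x' i = x i) ∧
      (∃ i ∈ insert p B, x' i = 1 ∨ x' i = -1) ∧
      ∑ a ∈ S, c a * (Real.exp (inner ℝ (θ a) (∑ i, x' i • v i)) *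
          walkFactor (Submodule.span ℝ (v '' B)) (v p) (θ a) (x' p)) ≤
        ∑ a ∈ S, c a * (Real.exp (inner ℝ (θ a) (∑ i, x i • v i)) *
          walkFactor (Submodule.span ℝ (v '' B)) (v p) (θ a) (x p)) := by
  set W := Submodule.span ℝ (v '' B) with hW
  obtain ⟨w, hw⟩ := Submodule.mem_span_image_finset_iff_exists_fun' ℝ |>.1
    (Submodule.starProjection_apply_mem W (v p))
  set u : ι → ℝ := fun i => if i = p then 1 else if i ∈ B then -w i else 0 with hu
  have hup : u p = 1 := by simp [hu]
  have huo : ∀ i, i ∉ insert p B → u i = 0 := fun i hi => by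
    rw [Finset.mem_insert, not_or] at hi
    simp [hu, hi.1, hi.2]
  have husum : ∑ i, u i • v i = v p - W.starProjection (v p) := by
    rw [← Finset.sum_subset (Finset.subset_univ (insert p B))
      (fun i _ hi => by rw [huo i hi, zero_smul]), Finset.sum_insert hp, hup, one_smul, ← hw,
      sub_eq_add_neg, ← Finset.sum_neg_distrib]
    congr 1
    refine Finset.sum_congr rfl fun i hi => ?_
    have : i ≠ p := fun h => hp (h ▸ hi)
    simp [hu, this, hi]
  set α : κ → ℝ := fun a => inner ℝ (θ a) (v p - W.starProjection (v p)) with hα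
  set C : κ → ℝ := fun a => c a * (Real.exp (inner ℝ (θ a) (∑ i, x i • v i)) *
    (Real.exp (‖(W ⊔ Submodule.span ℝ {v p}).starProjection (θ a)‖ ^ 2 / 2) *
      Real.exp (-(α a ^ 2 / 2) - α a * x p))) with hC
  have hlin : ∀ δ : ℝ, ∑ a ∈ S, c a * (Real.exp (inner ℝ (θ a) (∑ i, (x i + δ * u i) • v i)) *
      walkFactor W (v p) (θ a) (x p + δ * u p)) =
      ∑ a ∈ S, c a * (Real.exp (inner ℝ (θ a) (∑ i, x i • v i)) *
          walkFactor W (v p) (θ a) (x p)) + δ * ∑ a ∈ S, C a * Real.sinh (α a) := fun δ => by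
    rw [Finset.mul_sum, ← Finset.sum_add_distrib]
    refine Finset.sum_congr rfl fun a _ => ?_
    have h1 : inner ℝ (θ a) (∑ i, (x i + δ * u i) • v i) =
        inner ℝ (θ a) (∑ i, x i • v i) + δ * α a := by
      simp_rw [add_smul, mul_smul]
      rw [Finset.sum_add_distrib, ← Finset.smul_sum, husum, inner_add_right, inner_smul_right]
    have h2 : Real.exp (-(α a ^ 2 / 2) - α a * (x p + δ)) =
        Real.exp (-(α a ^ 2 / 2) - α a * x p) * (Real.exp (δ * α a))⁻¹ := by
      rw [← Real.exp_neg, ← Real.exp_add]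
      congr 1; ring
    rw [h1, hup, mul_one, Real.exp_add]
    simp only [walkFactor, pivotFactor, hC]
    rw [show inner ℝ (θ a) (v p - W.starProjection (v p)) = α a from rfl, h2]
    field_simp
    ring
  set F := ∑ a ∈ S, C a * Real.sinh (α a) with hF
  obtain ⟨δ, hδF, hbox, hhit⟩ : ∃ δ : ℝ, δ * F ≤ 0 ∧
      (∀ i ∈ insert p B, |x i + δ * u i| ≤ 1) ∧
      ∃ i ∈ insert p B, x i + δ * u i = 1 ∨ x i + δ * u i = -1 := by
    rcases le_total F 0 with h | h
    · obtain ⟨δ, h0, h1, h2⟩ := exists_step_to_boundary (Finset.mem_insert_self p B) x u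
        (fun i _ => hx i) (by rw [hup]; exact one_ne_zero)
      exact ⟨δ, mul_nonpos_of_nonneg_of_nonpos h0 h, h1, h2⟩
    · obtain ⟨δ, h0, h1, h2⟩ := exists_step_to_boundary (Finset.mem_insert_self p B) x (-u)
        (fun i _ => hx i) (by rw [Pi.neg_apply, hup]; norm_num)
      refine ⟨-δ, by nlinarith, ?_, ?_⟩
      · simpa using h1
      · simpa using h2
  refine ⟨fun i => x i + δ * u i, fun i => ?_, fun i hi => ?_, hhit, ?_⟩
  · by_cases hi : i ∈ insert p B
    · exact hbox i hi
    · simpa [huo i hi] using hx i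
  · simp [huo i hi]
  · rw [hlin]
    linarith

theorem exists_signs_le_walkFactor (v : ι → E) (hv : ∀ i, ‖v i‖ ≤ 1) (S : Finset κ) (c : κ → ℝ)
    (hc : ∀ a ∈ S, 0 ≤ c a) (θ : κ → E) (N : ℕ) :
    ∀ (B : Finset ι) (p : ι) (x : ι → ℝ), B.card = N → p ∉ B → (∀ i, |x i| ≤ 1) →
      (∀ i, i ∉ insert p B → x i = 1 ∨ x i = -1) →
      ∃ y : ι → ℝ, (∀ i, y i = 1 ∨ y i = -1) ∧ (∀ i, i ∉ insert p B → y i = x i) ∧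
        ∑ a ∈ S, c a * Real.exp (inner ℝ (θ a) (∑ i, y i • v i)) ≤
          ∑ a ∈ S, c a * (Real.exp (inner ℝ (θ a) (∑ i, x i • v i)) *
            walkFactor (Submodule.span ℝ (v '' B)) (v p) (θ a) (x p)) := by
  induction N with
  | zero =>
    intro B p x hB hp hx hxo
    obtain ⟨x', hx', hxo', ⟨i, hi, hhit⟩, hle⟩ := exists_step_of_walk v S c θ hp hx
    rw [Finset.card_eq_zero] at hB
    subst hB
    have hip : i = p := by simpa using hi
    subst hip
    refine ⟨x', fun j => ?_, hxo', le_trans ?_ hle⟩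
    · by_cases hj : j ∈ insert i (∅ : Finset ι)
      · have : j = i := by simpa using hj
        exact this ▸ hhit
      · rw [hxo' j hj]; exact hxo j hj
    · refine Finset.sum_le_sum fun a ha => mul_le_mul_of_nonneg_left ?_ (hc a ha)
      refine le_mul_of_one_le_right (Real.exp_pos _).le ?_
      refine le_trans ?_ (exp_le_walkFactor _ (hv i) (θ a) hhit)
      exact Real.one_le_exp (by positivity)
  | succ N ih =>
    intro B p x hB hp hx hxo
    obtain ⟨x', hx', hxo', ⟨i, hi, hhit⟩, hle⟩ := exists_step_of_walk v S c θ hp hx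
    obtain ⟨B', p', hB', hp', hins, hfac⟩ : ∃ (B' : Finset ι) (p' : ι), B'.card = N ∧ p' ∉ B' ∧
        insert p' B' = (insert p B).erase i ∧
        ∀ a, walkFactor (Submodule.span ℝ (v '' B')) (v p') (θ a) (x' p') ≤
          walkFactor (Submodule.span ℝ (v '' B)) (v p) (θ a) (x' p) := by
      by_cases hip : i = p
      · subst hip
        obtain ⟨q, hq⟩ : B.Nonempty := Finset.card_pos.1 (by omega)
        refine ⟨B.erase q, q, by rw [Finset.card_erase_of_mem hq]; omega,
          Finset.notMem_erase _ _, ?_, fun a => ?_⟩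
        · rw [Finset.insert_erase hq, Finset.erase_insert hp]
        -- The pivot froze: the old factor dominates `exp (‖P θ‖ ^ 2 / 2)`, with `P` the projection
        -- onto the span of `B`, and this dominates the factor of any new pivot `q` in `B`.
        · refine (walkFactor_le _ _ _ (hx' q)).trans ?_
          refine le_trans (Real.exp_le_exp.2 ?_) (exp_le_walkFactor _ (hv i) _ hhit)
          refine div_le_div_of_nonneg_right (norm_sq_starProjection_le_of_le ?_ _) two_pos.le
          refine sup_le (Submodule.span_mono (Set.image_mono ?_)) ?_
          · exact_mod_cast Finset.erase_subset q B
          · rw [Submodule.span_singleton_le_iff_mem]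
            exact Submodule.subset_span (Set.mem_image_of_mem v hq)
      · have hiB : i ∈ B := (Finset.mem_insert.1 hi).resolve_left hip
        refine ⟨B.erase i, p, by rw [Finset.card_erase_of_mem hiB]; omega,
          fun h => hp (Finset.mem_of_mem_erase h), ?_, fun a => ?_⟩
        · rw [Finset.erase_insert_of_ne (Ne.symm hip)]
        · refine walkFactor_mono (Submodule.span_mono (Set.image_mono ?_)) (hv p) _ (hx' p)
          exact_mod_cast Finset.erase_subset i B
    obtain ⟨y, hy, hyo, hyle⟩ := ih B' p' x' hB' hp' hx' fun j hj => by
      rw [hins, Finset.mem_erase, not_and_or, not_not] at hj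
      rcases hj with rfl | hj
      · exact hhit
      · rw [hxo' j hj]; exact hxo j hj
    refine ⟨y, hy, fun j hj => ?_, hyle.trans (le_trans ?_ hle)⟩
    · rw [hyo j, hxo' j hj]
      rw [hins]
      exact fun h => hj (Finset.mem_of_mem_erase h)
    · refine Finset.sum_le_sum fun a ha => mul_le_mul_of_nonneg_left ?_ (hc a ha)
      exact mul_le_mul_of_nonneg_left (hfac a) (Real.exp_pos _).le

/-- Vectors of norm at most `1` can be balanced, from any fractional starting point, so that the
exponential moments of the outcome are those of a standard Gaussian. -/
theorem exists_signs_sum_exp_le (v : ι → E) (hv : ∀ i, ‖v i‖ ≤ 1) (S : Finset κ) (c : κ → ℝ)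
    (hc : ∀ a ∈ S, 0 ≤ c a) (θ : κ → E) (x : ι → ℝ) (hx : ∀ i, |x i| ≤ 1) :
    ∃ y : ι → ℝ, (∀ i, y i = 1 ∨ y i = -1) ∧ (∀ i, x i = 1 ∨ x i = -1 → y i = x i) ∧
      ∑ a ∈ S, c a * Real.exp (inner ℝ (θ a) (∑ i, y i • v i)) ≤
        ∑ a ∈ S, c a * (Real.exp (inner ℝ (θ a) (∑ i, x i • v i)) *
          Real.exp (‖θ a‖ ^ 2 / 2)) := by
  set A : Finset ι := Finset.univ.filter fun i => ¬(x i = 1 ∨ x i = -1) with hA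
  rcases A.eq_empty_or_nonempty with h | ⟨p, hp⟩
  · refine ⟨x, fun i => ?_, fun _ _ => rfl, ?_⟩
    · by_contra hi
      have : i ∈ A := by simpa [hA] using hi
      simp [h] at this
    · refine Finset.sum_le_sum fun a ha => mul_le_mul_of_nonneg_left ?_ (hc a ha)
      exact le_mul_of_one_le_right (Real.exp_pos _).le (Real.one_le_exp (by positivity))
  · obtain ⟨y, hy, hyo, hle⟩ := exists_signs_le_walkFactor v hv S c hc θ _ (A.erase p) p x rfl
      (Finset.notMem_erase _ _) hx fun i hi => by
        rw [Finset.insert_erase hp] at hi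
        by_contra h
        exact hi (Finset.mem_filter.2 ⟨Finset.mem_univ _, h⟩)
    refine ⟨y, hy, fun i hi => hyo i ?_, hle.trans ?_⟩
    · rw [Finset.insert_erase hp]
      simp only [hA, Finset.mem_filter, not_and, not_not]
      exact fun _ => hi
    · refine Finset.sum_le_sum fun a ha => mul_le_mul_of_nonneg_left ?_ (hc a ha)
      refine mul_le_mul_of_nonneg_left ?_ (Real.exp_pos _).le
      refine (walkFactor_le _ _ _ (hx p)).trans (Real.exp_le_exp.2 ?_)
      gcongr
      exact Submodule.norm_starProjection_apply_le _ _

/-- Chernoff bound with a union over `S` and both signs: after scaling, each exponential is at most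
the total `2 |S| exp (r ^ 2 / 2)`, and logarithms are taken. -/
theorem exists_signs_abs_inner_le (v : ι → E) (S : Finset κ) (θ : κ → E) {Q : ℝ} (hQ : 0 < Q)
    (hv : ∀ i, ‖v i‖ ^ 2 ≤ Q) (hθ : ∀ a ∈ S, ‖θ a‖ ^ 2 ≤ Q) {r : ℝ} (hr : 0 < r)
    (x : ι → ℝ) (hx : ∀ i, |x i| ≤ 1) :
    ∃ y : ι → ℝ, (∀ i, y i = 1 ∨ y i = -1) ∧ (∀ i, x i = 1 ∨ x i = -1 → y i = x i) ∧
      ∀ a ∈ S, |∑ i, (y i - x i) * inner ℝ (θ a) (v i)| ≤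
        (Real.log (2 * S.card) / r + r / 2) * Q := by
  classical
  set R := Real.sqrt Q with hR
  have hRpos : 0 < R := Real.sqrt_pos.2 hQ
  have hRR : R * R = Q := Real.mul_self_sqrt hQ.le
  set S' : Finset (κ × Bool) := S ×ˢ Finset.univ with hS'
  set ε : Bool → ℝ := fun b => if b then 1 else -1 with hε
  set θ' : κ × Bool → E := fun a => (ε a.2 * r / R) • θ a.1 with hθ'
  set v' : ι → E := fun i => R⁻¹ • v i with hv'
  have hv1 : ∀ i, ‖v' i‖ ≤ 1 := fun i => by
    rw [hv', norm_smul, norm_inv, Real.norm_of_nonneg hRpos.le, inv_mul_le_one₀ hRpos]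
    exact Real.le_sqrt_of_sq_le (hv i)
  -- These weights recentre each exponential at the starting point `x`.
  obtain ⟨y, hy, hyo, hle⟩ := exists_signs_sum_exp_le v' hv1 S'
    (fun a => Real.exp (-inner ℝ (θ' a) (∑ i, x i • v' i))) (fun _ _ => (Real.exp_pos _).le) θ' x hx
  refine ⟨y, hy, hyo, fun a ha => ?_⟩
  have hθn : ∀ b ∈ S', ‖θ' b‖ ^ 2 ≤ r ^ 2 := fun b hb => by
    have h1 := hθ b.1 (Finset.mem_product.1 hb).1
    have h2 : ε b.2 ^ 2 = 1 := by simp only [hε]; split_ifs <;> norm_num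
    rw [hθ', norm_smul, mul_pow, Real.norm_eq_abs, sq_abs, div_pow, mul_pow, h2, one_mul, sq R, hRR,
      div_mul_eq_mul_div, div_le_iff₀ hQ]
    gcongr
  have hrhs : ∑ b ∈ S', Real.exp (-inner ℝ (θ' b) (∑ i, x i • v' i)) *
      (Real.exp (inner ℝ (θ' b) (∑ i, x i • v' i)) * Real.exp (‖θ' b‖ ^ 2 / 2)) ≤
      (2 * S.card) * Real.exp (r ^ 2 / 2) := by
    calc _ ≤ ∑ b ∈ S', Real.exp (r ^ 2 / 2) := by
          refine Finset.sum_le_sum fun b hb => ?_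
          rw [← mul_assoc, ← Real.exp_add, neg_add_cancel, Real.exp_zero, one_mul]
          have := hθn b hb
          gcongr
      _ = _ := by
          rw [Finset.sum_const, nsmul_eq_mul, hS', Finset.card_product]
          simp [mul_comm]
  have hScard : (0 : ℝ) < S.card := by exact_mod_cast Finset.card_pos.2 ⟨a, ha⟩
  set X := ∑ i, (y i - x i) * inner ℝ (θ a) (v i) with hX
  have hone : ∀ b : Bool, ε b * X ≤ (Real.log (2 * S.card) / r + r / 2) * Q := fun b => by
    have hb : (a, b) ∈ S' := Finset.mem_product.2 ⟨ha, Finset.mem_univ _⟩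
    have h1 := (Finset.single_le_sum (f := fun b => Real.exp (-inner ℝ (θ' b) (∑ i, x i • v' i)) *
      Real.exp (inner ℝ (θ' b) (∑ i, y i • v' i))) (fun _ _ => by positivity) hb).trans
      (hle.trans hrhs)
    have h2 : -inner ℝ (θ' (a, b)) (∑ i, x i • v' i) + inner ℝ (θ' (a, b)) (∑ i, y i • v' i) =
        r / Q * (ε b * X) := by
      rw [neg_add_eq_sub, ← inner_sub_right, ← Finset.sum_sub_distrib, inner_sum, hX, Finset.mul_sum,
        Finset.mul_sum]
      refine Finset.sum_congr rfl fun i _ => ?_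
      rw [← sub_smul, inner_smul_right]
      simp only [hθ', hv', inner_smul_left, inner_smul_right, ← hRR]
      simp
      field_simp
    beta_reduce at h1
    rw [← Real.exp_add, h2, ← Real.le_log_iff_exp_le (by positivity),
      Real.log_mul (by positivity) (Real.exp_pos _).ne', Real.log_exp] at h1
    rw [div_mul_eq_mul_div, div_le_iff₀ hQ] at h1
    have h3 : (Real.log (2 * S.card) / r + r / 2) * Q =
        (Real.log (2 * S.card) + r ^ 2 / 2) * Q / r := by field_simp
    rw [h3, le_div_iff₀ hr]
    linarith
  refine abs_le.2 ⟨?_, by simpa [hε] using hone true⟩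
  have := hone false
  simp [hε] at this
  linarith

end Walk

/-! ### Dyadic factorisation of anchored boxes, and rounding on a grid. -/

/-- `i < a` exactly when, at the highest binary digit where they differ, `i` has `0` and `a` has
`1`. At most one level `l` contributes. The induction strips the lowest digit. -/
theorem sum_range_first_differing_digit (k : ℕ) : ∀ i a : ℕ, i < 2 ^ k → a < 2 ^ k →
    ∑ l ∈ Finset.range k, (if (i / 2 ^ l % 2 = 0 ∧ i / 2 ^ (l + 1) = a / 2 ^ (l + 1)) ∧
      a / 2 ^ l % 2 = 1 then (1 : ℝ) else 0) = if i < a then 1 else 0 := by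
  induction k with
  | zero =>
    intro i a hi ha
    have : ¬ i < a := by simp at hi ha; omega
    simp [this]
  | succ k ih =>
    intro i a hi ha
    rw [pow_succ] at hi ha
    rw [Finset.sum_range_succ']
    have h := ih (i / 2) (a / 2) (by omega) (by omega)
    simp only [Nat.div_div_eq_div_mul, ← pow_succ'] at h
    rw [h]
    simp only [pow_zero, Nat.div_one, zero_add, pow_one]
    by_cases h1 : i / 2 < a / 2
    · have h2 : i < a := by omega
      have h3 : ¬ (i / 2 = a / 2) := by omega
      simp [h1, h2, h3]
    · by_cases h2 : i < a
      · have h3 : (i % 2 = 0 ∧ i / 2 = a / 2) ∧ a % 2 = 1 := by omega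
        simp [h2, h3]
      · have h3 : ¬ ((i % 2 = 0 ∧ i / 2 = a / 2) ∧ a % 2 = 1) := by omega
        rw [if_neg h1, if_neg h2, if_neg h3, add_zero]

/-- The left dyadic intervals containing `i`: the entry at `(l, b)` belongs to the interval of
length `2 ^ l` that is the left half of the `b`-th interval of length `2 ^ (l + 1)`. -/
def dyadicPoint (k i : ℕ) (q : Fin k × Fin (2 ^ k)) : ℝ :=
  if i / 2 ^ q.1.1 % 2 = 0 ∧ i / 2 ^ (q.1.1 + 1) = q.2.1 then 1 else 0

/-- The left dyadic intervals whose disjoint union is `[0, a)`. -/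
def dyadicPrefix (k a : ℕ) (q : Fin k × Fin (2 ^ k)) : ℝ :=
  if a / 2 ^ q.1.1 % 2 = 1 ∧ a / 2 ^ (q.1.1 + 1) = q.2.1 then 1 else 0

theorem sum_fin_ite_and_eq_le_one (m : ℕ) (P : Prop) [Decidable P] (x : ℕ) :
    ∑ b : Fin m, (if P ∧ x = b.1 then (1 : ℝ) else 0) ^ 2 ≤ 1 := by
  by_cases hx : x < m
  · rw [Finset.sum_eq_single_of_mem (⟨x, hx⟩ : Fin m) (Finset.mem_univ _)]
    · split_ifs <;> norm_num
    · intro b _ hb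
      have : x ≠ b.1 := fun h => hb (Fin.ext h.symm)
      simp [this]
  · rw [Finset.sum_eq_zero]
    · norm_num
    · intro b _
      have : x ≠ b.1 := by omega
      simp [this]

theorem sum_sq_dyadicPoint_le (k i : ℕ) : ∑ q, dyadicPoint k i q ^ 2 ≤ k := by
  have h : ∀ l ∈ (Finset.univ : Finset (Fin k)),
      ∑ b : Fin (2 ^ k), dyadicPoint k i (l, b) ^ 2 ≤ 1 := fun l _ =>
    sum_fin_ite_and_eq_le_one (2 ^ k) (i / 2 ^ l.1 % 2 = 0) (i / 2 ^ (l.1 + 1))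
  rw [Fintype.sum_prod_type]
  exact (Finset.sum_le_card_nsmul _ _ _ h).trans_eq (by simp)

theorem sum_sq_dyadicPrefix_le (k a : ℕ) : ∑ q, dyadicPrefix k a q ^ 2 ≤ k := by
  have h : ∀ l ∈ (Finset.univ : Finset (Fin k)),
      ∑ b : Fin (2 ^ k), dyadicPrefix k a (l, b) ^ 2 ≤ 1 := fun l _ =>
    sum_fin_ite_and_eq_le_one (2 ^ k) (a / 2 ^ l.1 % 2 = 1) (a / 2 ^ (l.1 + 1))
  rw [Fintype.sum_prod_type]
  exact (Finset.sum_le_card_nsmul _ _ _ h).trans_eq (by simp)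

theorem sum_dyadicPrefix_mul_dyadicPoint {k : ℕ} {i a : ℕ} (hi : i < 2 ^ k) (ha : a < 2 ^ k) :
    ∑ q, dyadicPrefix k a q * dyadicPoint k i q = if i < a then 1 else 0 := by
  rw [← sum_range_first_differing_digit k i a hi ha, Fintype.sum_prod_type, Finset.sum_range]
  refine Finset.sum_congr rfl fun l _ => ?_
  have hlt : i / 2 ^ (l.1 + 1) < 2 ^ k := (Nat.div_le_self _ _).trans_lt hi
  rw [Finset.sum_eq_single_of_mem (⟨_, hlt⟩ : Fin (2 ^ k)) (Finset.mem_univ _)]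
  · simp only [dyadicPrefix, dyadicPoint, ← ite_and, mul_ite, mul_one, mul_zero, and_true]
    refine if_congr ?_ rfl rfl
    constructor
    · rintro ⟨h1, h2, h3⟩; exact ⟨⟨h1, h3.symm⟩, h2⟩
    · rintro ⟨⟨h1, h3⟩, h2⟩; exact ⟨h1, h2, h3.symm⟩
  · intro b _ hb
    have : ¬ (i / 2 ^ (l.1 + 1) = b.1) := fun h => hb (Fin.ext h.symm)
    simp [dyadicPoint, this]

theorem prod_sum_eq_sum_prod {d : ℕ} {κ : Type*} [Fintype κ] (f : Fin d → κ → ℝ) :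
    ∑ g : Fin d → κ, ∏ j, f j (g j) = ∏ j, ∑ q, f j q := by
  classical
  rw [Finset.prod_univ_sum, Fintype.piFinset_univ]

/-- The pure tensor with factors `f j`. -/
noncomputable def tensorVec {d : ℕ} {κ : Type*} (f : Fin d → κ → ℝ) :
    EuclideanSpace ℝ (Fin d → κ) :=
  WithLp.toLp 2 fun g => ∏ j, f j (g j)

theorem inner_tensorVec {d : ℕ} {κ : Type*} [Fintype κ] (f g : Fin d → κ → ℝ) :
    inner ℝ (tensorVec f) (tensorVec g) = ∏ j, ∑ q, f j q * g j q := by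
  rw [← prod_sum_eq_sum_prod fun j q => f j q * g j q]
  simp [tensorVec, PiLp.inner_apply, Finset.prod_mul_distrib, mul_comm]

theorem norm_sq_tensorVec_le {d : ℕ} {κ : Type*} [Fintype κ] (f : Fin d → κ → ℝ) {k : ℝ}
    (hf : ∀ j, ∑ q, f j q ^ 2 ≤ k) : ‖tensorVec f‖ ^ 2 ≤ k ^ d := by
  rw [← real_inner_self_eq_norm_sq, inner_tensorVec]
  calc _ ≤ ∏ _j : Fin d, k := Finset.prod_le_prod
        (fun j _ => Finset.sum_nonneg fun q _ => mul_self_nonneg _)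
        (fun j _ => by simpa only [sq] using hf j)
    _ = k ^ d := by simp

/-- Weights on the grid `[0, 2 ^ k) ^ d` can be rounded to integers with small error on every
anchored box. -/
theorem exists_nat_rounding_of_grid {d k : ℕ} (hk : 1 ≤ k) (w : (Fin d → Fin (2 ^ k)) → ℝ)
    (hw : ∀ c, 0 ≤ w c) {r : ℝ} (hr : 0 < r) :
    ∃ N : (Fin d → Fin (2 ^ k)) → ℕ, (∀ c, w c = 0 → N c = 0) ∧
      ∀ a : Fin d → Fin (2 ^ k), |∑ c with ∀ j, c j < a j, ((N c : ℝ) - w c)| ≤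
        (Real.log (2 * 2 ^ (k * d)) / r + r / 2) * k ^ d / 2 := by
  have hQ : (0 : ℝ) < (k : ℝ) ^ d := by positivity
  set v : (Fin d → Fin (2 ^ k)) → EuclideanSpace ℝ (Fin d → Fin k × Fin (2 ^ k)) :=
    fun c => tensorVec fun j => dyadicPoint k (c j)
  set θ : (Fin d → Fin (2 ^ k)) → EuclideanSpace ℝ (Fin d → Fin k × Fin (2 ^ k)) :=
    fun c => tensorVec fun j => dyadicPrefix k (c j)
  have hin : ∀ a c, inner ℝ (θ a) (v c) = if ∀ j, c j < a j then (1 : ℝ) else 0 := fun a c => by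
    rw [inner_tensorVec]
    simp_rw [sum_dyadicPrefix_mul_dyadicPoint (c _).2 (a _).2, Fin.val_fin_lt]
    by_cases h : ∀ j, c j < a j
    · simp [h]
    · rw [if_neg h]
      push Not at h
      obtain ⟨j, hj⟩ := h
      exact Finset.prod_eq_zero (Finset.mem_univ j) (by simp [hj])
  -- Fractional parts are mapped affinely to `[-1, 1)`, with `1` meaning rounding up. An integer
  -- weight starts at `-1` and stays there, so empty cells receive no points.
  obtain ⟨y, hy, hyo, hle⟩ := exists_signs_abs_inner_le v Finset.univ θ hQ
    (fun c => norm_sq_tensorVec_le _ fun j => sum_sq_dyadicPoint_le _ _)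
    (fun c _ => norm_sq_tensorVec_le _ fun j => sum_sq_dyadicPrefix_le _ _) hr
    (fun c => 2 * Int.fract (w c) - 1) (fun c => by
      have h1 := Int.fract_nonneg (w c)
      have h2 := Int.fract_lt_one (w c)
      rw [abs_le]; constructor <;> linarith)
  refine ⟨fun c => ⌊w c⌋₊ + if y c = 1 then 1 else 0, fun c hc => ?_, fun a => ?_⟩
  · have : y c = -1 := by
      have h := hyo c (by simp [hc])
      simpa [hc] using h
    simp only [this, hc]
    norm_num
  · have h := hle a (Finset.mem_univ _)
    have hterm : ∀ c, ((⌊w c⌋₊ + if y c = 1 then 1 else 0 : ℕ) : ℝ) - w c =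
        (y c - (2 * Int.fract (w c) - 1)) / 2 := fun c => by
      have h1 : (⌊w c⌋₊ : ℝ) = w c - Int.fract (w c) := by
        rw [natCast_floor_eq_intCast_floor (hw c), Int.self_sub_fract]
      rw [Nat.cast_add, h1]
      rcases hy c with h | h
      · rw [if_pos h, h]; push_cast; ring
      · rw [if_neg (by rw [h]; norm_num), h]; push_cast; ring
    simp_rw [hterm]
    simp_rw [hin, mul_ite, mul_one, mul_zero, ← Finset.sum_filter] at h
    rw [← Finset.sum_div, abs_div, abs_two]
    refine div_le_div_of_nonneg_right ?_ two_pos.le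
    have hcard : ((Finset.univ : Finset (Fin d → Fin (2 ^ k))).card : ℝ) = 2 ^ (k * d) := by
      simp [pow_mul]
    rwa [hcard] at h

/-! ### Quantile partition of the line. -/

/-- The index of the cell of `x` in a partition of the line, into consecutive intervals, that is
adapted to the `1 / n`-quantiles of `μ`. -/
noncomputable def quantileCell (μ : Measure ℝ) (n : ℕ) (x : ℝ) : ℕ :=
  ⌊n * μ.real (Set.Iio x)⌋₊ + ⌈n * μ.real (Set.Iic x)⌉₊

section Quantile

variable (μ : Measure ℝ) [IsProbabilityMeasure μ] (n : ℕ)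

theorem monotone_floor_measureReal_Iio : Monotone fun x => ⌊n * μ.real (Set.Iio x)⌋₊ :=
  fun _ _ h => Nat.floor_mono
    (mul_le_mul_of_nonneg_left (measureReal_mono (Set.Iio_subset_Iio h)) n.cast_nonneg)

theorem monotone_ceil_measureReal_Iic : Monotone fun x => ⌈n * μ.real (Set.Iic x)⌉₊ :=
  fun _ _ h => Nat.ceil_mono
    (mul_le_mul_of_nonneg_left (measureReal_mono (Set.Iic_subset_Iic.2 h)) n.cast_nonneg)

theorem monotone_quantileCell : Monotone (quantileCell μ n) :=
  (monotone_floor_measureReal_Iio μ n).add (monotone_ceil_measureReal_Iic μ n)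

theorem quantileCell_le (x : ℝ) : quantileCell μ n x ≤ 2 * n := by
  have h : ∀ s : Set ℝ, n * μ.real s ≤ n := fun s =>
    mul_le_of_le_one_right n.cast_nonneg measureReal_le_one
  have h1 : ⌊n * μ.real (Set.Iio x)⌋₊ ≤ n := Nat.floor_le_of_le (h _)
  have h2 : ⌈n * μ.real (Set.Iic x)⌉₊ ≤ n := Nat.ceil_le.2 (h _)
  unfold quantileCell
  omega

/-- Every point is either the least one of its cell, or its cell has mass at most `1 / n`. -/
theorem quantileCell_ne_or_measureReal_le (y : ℝ) :
    (∀ x < y, quantileCell μ n x ≠ quantileCell μ n y) ∨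
      n * μ.real (quantileCell μ n ⁻¹' {quantileCell μ n y}) ≤ 1 := by
  rw [or_iff_not_imp_left]
  intro h
  push Not at h
  obtain ⟨z, hzy, hz⟩ := h
  set f : ℝ → ℕ := fun x => ⌊n * μ.real (Set.Iio x)⌋₊ with hf
  set g : ℝ → ℕ := fun x => ⌈n * μ.real (Set.Iic x)⌉₊ with hg
  have hfm : Monotone f := monotone_floor_measureReal_Iio μ n
  have hgm : Monotone g := monotone_ceil_measureReal_Iic μ n
  have hconst : ∀ x, quantileCell μ n x = quantileCell μ n y → f x = f y ∧ g x = g y := by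
    intro x hx
    have hx' : f x + g x = f y + g y := hx
    rcases le_total x y with h | h
    · have h1 := hfm h
      have h2 := hgm h
      omega
    · have h1 := hfm h
      have h2 := hgm h
      omega
  -- A smaller point `z` in the same cell ties the ceiling at `z` to the floor at `y`; this excludes
  -- a heavy atom at `y`.
  have hgf : g y ≤ f y + 1 := by
    rw [← (hconst z hz).2]
    refine Nat.ceil_le.2 ?_
    have h1 : n * μ.real (Set.Iic z) ≤ n * μ.real (Set.Iio y) :=
      mul_le_mul_of_nonneg_left (measureReal_mono fun t ht => lt_of_le_of_lt ht hzy) n.cast_nonneg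
    have h2 := (Nat.lt_floor_add_one (n * μ.real (Set.Iio y))).le
    push_cast
    exact h1.trans h2
  have hIcc : ∀ x x', x ≤ x' → quantileCell μ n x = quantileCell μ n y →
      quantileCell μ n x' = quantileCell μ n y → n * μ.real (Set.Icc x x') ≤ 1 := by
    intro x x' hxx hx hx'
    have h1 : μ.real (Set.Icc x x') = μ.real (Set.Iic x') - μ.real (Set.Iio x) := by
      rw [← measureReal_sdiff _ measurableSet_Iio]
      · congr 1; ext t; simp
      · exact fun t ht => (le_of_lt ht).trans hxx
    have h2 : n * μ.real (Set.Iic x') ≤ g y := by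
      rw [← (hconst x' hx').2]; exact Nat.le_ceil _
    have h3 : (f y : ℝ) ≤ n * μ.real (Set.Iio x) := by
      rw [← (hconst x hx).1]
      exact Nat.floor_le (by positivity)
    have h4 : (g y : ℝ) ≤ f y + 1 := by exact_mod_cast hgf
    rw [h1, mul_sub]
    linarith
  have hmeas : MeasurableSet (quantileCell μ n ⁻¹' {quantileCell μ n y}) :=
    (monotone_quantileCell μ n).measurable (measurableSet_singleton _)
  by_contra! hlt
  have hn : (0 : ℝ) < n := by
    rcases n.cast_nonneg (α := ℝ) |>.eq_or_lt with h | h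
    · rw [← h] at hlt; norm_num at hlt
    · exact h
  have hlt' : ENNReal.ofReal (1 / n) < μ (quantileCell μ n ⁻¹' {quantileCell μ n y}) := by
    rw [← ofReal_measureReal]
    refine (ENNReal.ofReal_lt_ofReal_iff_of_nonneg (by positivity)).2 ?_
    rwa [div_lt_iff₀' hn]
  -- The cell may lack endpoints; inner regularity gives a compact subset, enclosed in a closed
  -- interval with endpoints in the cell, where `hIcc` applies.
  obtain ⟨C, hC, hCc, hCμ⟩ := hmeas.exists_lt_isCompact_of_ne_top (measure_ne_top _ _) hlt'
  have hne : C.Nonempty := by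
    rw [Set.nonempty_iff_ne_empty]
    rintro rfl
    simp at hCμ
  obtain ⟨a, ha⟩ := hCc.exists_isLeast hne
  obtain ⟨b, hb⟩ := hCc.exists_isGreatest hne
  have h1 := hIcc a b (ha.2 hb.1) (hC ha.1) (hC hb.1)
  have h2 : μ C ≤ μ (Set.Icc a b) := measure_mono fun t ht => ⟨ha.2 ht, hb.2 ht⟩
  have h3 := hCμ.trans_le h2
  rw [← ofReal_measureReal, ENNReal.ofReal_lt_ofReal_iff_of_nonneg (by positivity),
    div_lt_iff₀' hn] at h3
  linarith

end Quantile

/-! ### From integer weights to exactly `n` points. -/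

/-- Take `N c` copies of `pt c`, then truncate or pad to length `n`; no count changes by more than
the defect of the total. -/
theorem exists_points_card_sub_le {G κ : Type*} [Nonempty G] [Fintype κ] (N : κ → ℕ) (pt : κ → G)
    (n : ℕ) : ∃ f : Fin n → G, ∀ P : G → Prop, ∀ [DecidablePred P],
      |((Finset.univ.filter fun i => P (f i)).card : ℝ) - ∑ c with P (pt c), (N c : ℝ)| ≤
        |∑ c, (N c : ℝ) - n| := by
  classical
  obtain ⟨g₀⟩ := ‹Nonempty G›
  set M : Multiset G := ∑ c, Multiset.replicate (N c) (pt c) with hM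
  have hcard : M.card = ∑ c, N c := by simp [hM]
  have hcount : ∀ P : G → Prop, ∀ [DecidablePred P], M.countP P = ∑ c with P (pt c), N c := by
    intro P _
    have h1 : M.countP P = ∑ c, (Multiset.replicate (N c) (pt c)).countP P :=
      map_sum (Multiset.countPAddMonoidHom P) _ _
    rw [h1, Finset.sum_filter]
    refine Finset.sum_congr rfl fun c _ => ?_
    rw [← Multiset.coe_replicate, Multiset.coe_countP, List.countP_replicate]
    simp
  obtain ⟨L, hL, hLM⟩ : ∃ L : Multiset G, L.card = n ∧ ∀ P : G → Prop, ∀ [DecidablePred P],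
      |(L.countP P : ℝ) - M.countP P| ≤ |(M.card : ℝ) - n| := by
    rcases le_total n M.card with h | h
    · obtain ⟨L, R, hLM, hL⟩ : ∃ L R : Multiset G, M = L + R ∧ L.card = n := by
        refine ⟨(M.toList.take n : List G), (M.toList.drop n : List G), ?_, ?_⟩
        · rw [Multiset.coe_add, List.take_append_drop, Multiset.coe_toList]
        · simpa using h
      rw [hLM]
      refine ⟨L, hL, fun P _ => ?_⟩
      have h1 : (R.countP P : ℝ) ≤ R.card := by exact_mod_cast Multiset.countP_le_card P R
      rw [Multiset.countP_add, Multiset.card_add, hL]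
      push_cast
      rw [sub_add_cancel_left, add_sub_cancel_left, abs_neg, Nat.abs_cast, Nat.abs_cast]
      exact h1
    · refine ⟨M + Multiset.replicate (n - M.card) g₀, by simp; omega, fun P _ => ?_⟩
      have h1 : ((Multiset.replicate (n - M.card) g₀).countP P : ℝ) ≤ (n - M.card : ℕ) := by
        exact_mod_cast (Multiset.countP_le_card P _).trans_eq (Multiset.card_replicate _ _)
      rw [Nat.cast_sub h] at h1
      rw [Multiset.countP_add]
      push_cast
      rw [add_sub_cancel_left, Nat.abs_cast, abs_sub_comm]
      exact h1.trans (le_abs_self _)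
  obtain ⟨l, rfl⟩ := Quot.exists_rep L
  have hl : l.length = n := hL
  subst hl
  refine ⟨l.get, fun P _ => ?_⟩
  have h1 : (Finset.univ.filter fun i => P (l.get i)).card = l.countP P := by
    calc _ = Multiset.countP P (Finset.univ.val.map l.get) := by
          rw [Multiset.countP_map]; rfl
      _ = _ := by rw [Fin.univ_val_map, List.ofFn_get, Multiset.coe_countP]
  have h2 := hLM P
  rw [hcard, hcount] at h2
  push_cast at h2
  rw [h1]
  exact h2

/-- The error allowed on the anchored boxes of a grid with `(2 ^ k) ^ d` cells. -/
noncomputable def gridError (d k : ℕ) (r : ℝ) : ℝ :=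
  (Real.log (2 * 2 ^ (k * d)) / r + r / 2) * k ^ d / 2

/-- The grid error enters twice: once for the box, once for correcting the total to `n`. -/
theorem exists_points_card_sub_measureReal_le {G : Type*} [MeasurableSpace G] (π : Measure G)
    [IsProbabilityMeasure π] {d k n : ℕ} (hk : 1 ≤ k) (cell : G → Fin d → Fin (2 ^ k))
    (hcell : Measurable cell) (last : Fin (2 ^ k)) (hlast : ∀ g j, cell g j < last) {r : ℝ}
    (hr : 0 < r) :
    ∃ f : Fin n → G, ∀ a : Fin d → Fin (2 ^ k),
      |((Finset.univ.filter fun i => ∀ j, cell (f i) j < a j).card : ℝ) -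
        n * π.real {g | ∀ j, cell g j < a j}| ≤ 2 * gridError d k r := by
  classical
  have hne : Nonempty G := nonempty_of_isProbabilityMeasure π
  set w : (Fin d → Fin (2 ^ k)) → ℝ := fun c => n * π.real (cell ⁻¹' {c}) with hw
  have hwsum : ∀ T : Finset (Fin d → Fin (2 ^ k)), ∑ c ∈ T, w c = n * π.real (cell ⁻¹' T) :=
    fun T => by
      rw [← Finset.mul_sum, sum_measureReal_preimage_singleton]
      exact fun c _ => hcell (measurableSet_singleton c)
  obtain ⟨N, hN0, hN⟩ := exists_nat_rounding_of_grid hk w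
    (fun c => mul_nonneg n.cast_nonneg measureReal_nonneg) hr
  have hpre : ∀ c, N c ≠ 0 → ∃ g, cell g = c := fun c hc => by
    by_contra! h
    have : cell ⁻¹' {c} = ∅ := Set.eq_empty_of_forall_notMem fun g hg => h g hg
    exact hc (hN0 c (by simp [hw, this]))
  choose! pt hpt using hpre
  obtain ⟨f, hf⟩ := exists_points_card_sub_le N pt n
  -- No point has a cell index reaching `last`, so the box with corner `last` carries all the weight
  -- and controls the total.
  have htot : |∑ c, (N c : ℝ) - n| ≤ gridError d k r := by
    have h := hN fun _ => last
    have h1 : ∑ c with ∀ j, c j < last, ((N c : ℝ) - w c) = ∑ c, ((N c : ℝ) - w c) := by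
      refine Finset.sum_subset (Finset.filter_subset _ _) fun c _ hc => ?_
      have hempty : cell ⁻¹' {c} = ∅ := Set.eq_empty_of_forall_notMem fun g hg => by
        refine hc (Finset.mem_filter.2 ⟨Finset.mem_univ _, fun j => ?_⟩)
        rw [← (show cell g = c from hg)]
        exact hlast g j
      have hw0 : w c = 0 := by simp [hw, hempty]
      rw [hw0, hN0 c hw0]
      simp
    have h2 : ∑ c, w c = n := by
      rw [hwsum Finset.univ]
      simp
    rw [h1, Finset.sum_sub_distrib, h2] at h
    exact h
  refine ⟨f, fun a => ?_⟩
  have h1 := hf fun g => ∀ j, cell g j < a j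
  have h2 : ∑ c with ∀ j, cell (pt c) j < a j, (N c : ℝ) = ∑ c with ∀ j, c j < a j, (N c : ℝ) := by
    rw [Finset.sum_filter, Finset.sum_filter]
    refine Finset.sum_congr rfl fun c _ => ?_
    by_cases hc : N c = 0
    · simp [hc]
    · rw [hpt c hc]
  have h3 := hN a
  rw [Finset.sum_sub_distrib, hwsum] at h3
  have h4 : cell ⁻¹' (Finset.univ.filter fun c : Fin d → Fin (2 ^ k) => ∀ j, c j < a j) =
      {g | ∀ j, cell g j < a j} := by
    ext g; simp
  rw [h4] at h3
  rw [h2] at h1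
  have h5 := abs_sub_le ((Finset.univ.filter fun i => ∀ j, cell (f i) j < a j).card : ℝ)
    (∑ c with ∀ j, c j < a j, (N c : ℝ)) (n * π.real {g | ∀ j, cell g j < a j})
  have h6 : |∑ c with ∀ j, c j < a j, (N c : ℝ) - n * π.real {g | ∀ j, cell g j < a j}| ≤
      gridError d k r := h3
  linarith

theorem exists_points_anchoredBox_error_le {d : ℕ} {G : Set (Fin d → ℝ)} (π : Measure G)
    [IsProbabilityMeasure π] (n : ℕ) {r : ℝ} (hr : 0 < r) :
    ∃ f : Fin n → G, ∀ y : Fin d → ℝ,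
      |((Finset.univ.filter fun i => ∀ j, (f i : Fin d → ℝ) j < y j).card : ℝ) -
        n * π.real {g : G | ∀ j, (g : Fin d → ℝ) j < y j}| ≤
        2 * gridError d (2 + Nat.log 2 n) r + d := by
  classical
  set k := 2 + Nat.log 2 n with hk
  -- Cell indices are at most `2 * n`; one spare index is needed for `last` and for the shifted
  -- corner `b`.
  have hkn : 2 * n + 1 < 2 ^ k := by
    have := Nat.lt_pow_succ_log_self one_lt_two n
    rw [hk, show 2 + Nat.log 2 n = (Nat.log 2 n).succ + 1 by omega, pow_succ]
    omega
  have hproj : ∀ j, Measurable fun g : G => (g : Fin d → ℝ) j := fun j =>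
    (measurable_pi_apply j).comp measurable_subtype_coe
  set μ : Fin d → Measure ℝ := fun j => π.map fun g : G => (g : Fin d → ℝ) j with hμ
  have hμp : ∀ j, IsProbabilityMeasure (μ j) := fun j =>
    Measure.isProbabilityMeasure_map (hproj j).aemeasurable
  set cell : G → Fin d → Fin (2 ^ k) := fun g j =>
    ⟨quantileCell (μ j) n ((g : Fin d → ℝ) j), by
      have := quantileCell_le (μ j) n ((g : Fin d → ℝ) j)
      omega⟩ with hcell
  have hcellm : Measurable cell := measurable_pi_iff.2 fun j => by
    refine measurable_to_countable' fun q => ?_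
    have : (fun g => cell g j) ⁻¹' {q} =
        (fun g : G => quantileCell (μ j) n ((g : Fin d → ℝ) j)) ⁻¹' {q.1} := by
      ext g; simp [hcell, Fin.ext_iff]
    rw [this]
    exact ((monotone_quantileCell (μ j) n).measurable.comp (hproj j)) (measurableSet_singleton _)
  obtain ⟨f, hf⟩ := exists_points_card_sub_measureReal_le (n := n) π (by omega : 1 ≤ k) cell hcellm
    ⟨2 * n + 1, hkn⟩ (fun g j => by
      have := quantileCell_le (μ j) n ((g : Fin d → ℝ) j)
      rw [Fin.lt_def]
      simp only [hcell]
      omega) hr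
  refine ⟨f, fun y => ?_⟩
  -- The axes on which `y j` is not the least point of its cell. Only there do the inner corner `a`
  -- and the outer corner `b` differ, by one cell of mass at most `1 / n`.
  set J : Finset (Fin d) := Finset.univ.filter fun j =>
    ¬ ∀ x < y j, quantileCell (μ j) n x ≠ quantileCell (μ j) n (y j) with hJ
  have hyle : ∀ j, quantileCell (μ j) n (y j) ≤ 2 * n := fun j => quantileCell_le (μ j) n (y j)
  set a : Fin d → Fin (2 ^ k) := fun j =>
    ⟨quantileCell (μ j) n (y j), by have := hyle j; omega⟩ with ha
  set b : Fin d → Fin (2 ^ k) := fun j =>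
    ⟨quantileCell (μ j) n (y j) + if j ∈ J then 1 else 0, by
      have := hyle j
      split_ifs <;> omega⟩ with hb
  set box : Set G := {g : G | ∀ j, (g : Fin d → ℝ) j < y j} with hbox
  have hsub1 : ∀ g : G, (∀ j, cell g j < a j) → ∀ j, (g : Fin d → ℝ) j < y j := fun g hg j =>
    (monotone_quantileCell (μ j) n).reflect_lt (hg j)
  have hsub2 : ∀ g : G, (∀ j, (g : Fin d → ℝ) j < y j) → ∀ j, cell g j < b j := fun g hg j => by
    have h1 := monotone_quantileCell (μ j) n (hg j).le
    rw [Fin.lt_def]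
    simp only [hcell, hb]
    by_cases hj : j ∈ J
    · rw [if_pos hj]; omega
    · rw [if_neg hj]
      have h2 : ∀ x < y j, quantileCell (μ j) n x ≠ quantileCell (μ j) n (y j) := by
        simpa only [hJ, Finset.mem_filter, Finset.mem_univ, true_and, not_not] using hj
      have := h2 _ (hg j)
      omega
  have hcover : {g | ∀ j, cell g j < b j} ⊆ {g | ∀ j, cell g j < a j} ∪
      ⋃ j ∈ J, (fun g : G => (g : Fin d → ℝ) j) ⁻¹'
        (quantileCell (μ j) n ⁻¹' {quantileCell (μ j) n (y j)}) := fun g hg => by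
    by_cases h : ∀ j, cell g j < a j
    · exact Or.inl h
    · right
      push Not at h
      obtain ⟨j, hj⟩ := h
      have h1 : cell g j < b j := hg j
      rw [Fin.lt_def] at h1
      rw [Fin.le_def] at hj
      simp only [hcell, ha, hb] at h1 hj
      have hjJ : j ∈ J := by
        by_contra hjJ
        rw [if_neg hjJ] at h1
        omega
      rw [if_pos hjJ] at h1
      refine Set.mem_biUnion hjJ ?_
      simp only [Set.mem_preimage, Set.mem_singleton_iff]
      omega
  have hmass : n * π.real {g | ∀ j, cell g j < b j} ≤
      n * π.real {g | ∀ j, cell g j < a j} + d := by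
    have h1 : ∀ j ∈ J, n * π.real ((fun g : G => (g : Fin d → ℝ) j) ⁻¹'
        (quantileCell (μ j) n ⁻¹' {quantileCell (μ j) n (y j)})) ≤ 1 := fun j hj => by
      rw [← map_measureReal_apply (hproj j)
        ((monotone_quantileCell (μ j) n).measurable (measurableSet_singleton _))]
      exact (quantileCell_ne_or_measureReal_le (μ j) n (y j)).resolve_left
        (Finset.mem_filter.1 hj).2
    have h2 := (measureReal_mono (μ := π) hcover).trans (measureReal_union_le _ _)
    have h3 := h2.trans (add_le_add_right (measureReal_biUnion_finset_le J _) _)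
    have h4 := mul_le_mul_of_nonneg_left h3 n.cast_nonneg
    rw [mul_add, Finset.mul_sum] at h4
    have h5 := Finset.sum_le_card_nsmul J _ 1 h1
    have h6 : (J.card : ℝ) ≤ d := by
      exact_mod_cast (Finset.card_le_univ J).trans_eq (Fintype.card_fin d)
    rw [nsmul_one] at h5
    linarith
  have hm1 : π.real {g | ∀ j, cell g j < a j} ≤ π.real box := measureReal_mono hsub1
  have hm2 : π.real box ≤ π.real {g | ∀ j, cell g j < b j} := measureReal_mono hsub2
  have hn1 := mul_le_mul_of_nonneg_left hm1 (n.cast_nonneg (α := ℝ))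
  have hn2 := mul_le_mul_of_nonneg_left hm2 (n.cast_nonneg (α := ℝ))
  have hc1 : ((Finset.univ.filter fun i => ∀ j, cell (f i) j < a j).card : ℝ) ≤
      (Finset.univ.filter fun i => ∀ j, (f i : Fin d → ℝ) j < y j).card := by
    exact_mod_cast Finset.card_le_card (Finset.monotone_filter_right _ fun i _ => hsub1 (f i))
  have hc2 : ((Finset.univ.filter fun i => ∀ j, (f i : Fin d → ℝ) j < y j).card : ℝ) ≤
      (Finset.univ.filter fun i => ∀ j, cell (f i) j < b j).card := by
    exact_mod_cast Finset.card_le_card (Finset.monotone_filter_right _ fun i _ => hsub2 (f i))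
  have ha' := abs_le.1 (hf a)
  have hb' := abs_le.1 (hf b)
  rw [abs_le]
  constructor <;> linarith

/-! ### Numerical bound and the driver sequence. -/

/-- The choice of `r` balances `log / r` against `r / 2`, up to constants, giving `3 √d L ^ (d + 1 /
2) + d`. As `d + 1 / 2 ≤ (3 d + 1) / 2`, the constant `4` would already do. -/
theorem two_mul_gridError_add_le {d n : ℕ} (hd : 1 ≤ d) (hn : 1 ≤ n) :
    2 * gridError d (2 + Nat.log 2 n) (Real.sqrt (d * (2 + Real.logb 2 n))) + d ≤
      63 * Real.sqrt d * (2 + Real.logb 2 n) ^ ((3 * (d : ℝ) + 1) / 2) := by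
  set L := 2 + Real.logb 2 n with hL
  set k := 2 + Nat.log 2 n with hk
  have hn' : (1 : ℝ) ≤ n := by exact_mod_cast hn
  have hd' : (1 : ℝ) ≤ d := by exact_mod_cast hd
  have hkL : (k : ℝ) ≤ L := by
    rw [hk, hL]
    push_cast
    exact add_le_add_right (Real.natLog_le_logb n 2) 2
  have hL2 : 2 ≤ L := by
    have := Real.logb_nonneg one_lt_two hn'
    linarith
  set r := Real.sqrt (d * L) with hr
  have hdL : 2 ≤ d * L := by nlinarith
  have hrpos : 0 < r := Real.sqrt_pos.2 (by linarith)
  have hrr : r * r = d * L := Real.mul_self_sqrt (by linarith)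
  have hlog : Real.log (2 * 2 ^ (k * d)) ≤ 2 * (d * L) := by
    rw [← pow_succ', Real.log_pow]
    have h1 := Real.log_two_lt_d9
    have h2 := Real.log_two_gt_d9
    have h3 : (k : ℝ) * d ≤ d * L := by
      rw [mul_comm]
      exact mul_le_mul_of_nonneg_left hkL d.cast_nonneg
    push_cast
    have h4 := mul_le_mul_of_nonneg_right (add_le_add_left h3 1) (Real.log_pos one_lt_two).le
    nlinarith
  have hE : 2 * gridError d k r ≤ 3 * r * L ^ d := by
    have h1 : Real.log (2 * 2 ^ (k * d)) / r ≤ 2 * r := by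
      rw [div_le_iff₀ hrpos]; linarith
    have h2 : (k : ℝ) ^ d ≤ L ^ d := pow_le_pow_left₀ k.cast_nonneg hkL d
    have h3 : (Real.log (2 * 2 ^ (k * d)) / r + r / 2) * k ^ d ≤ (3 * r) * L ^ d :=
      mul_le_mul (by linarith) h2 (by positivity) (by positivity)
    rw [gridError]
    linarith
  set X := L ^ ((3 * (d : ℝ) + 1) / 2) with hX
  have hsqrt : Real.sqrt L * L ^ d ≤ X := by
    rw [Real.sqrt_eq_rpow, ← Real.rpow_natCast, ← Real.rpow_add (by linarith)]
    exact Real.rpow_le_rpow_of_exponent_le (by linarith) (by linarith)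
  have hsL : 1 ≤ Real.sqrt L := Real.one_le_sqrt.2 (by linarith)
  have hdX : Real.sqrt d ≤ X := by
    have h1 : Real.sqrt d ≤ d := Real.sqrt_le_iff.2 ⟨d.cast_nonneg, by nlinarith⟩
    have h2 : (d : ℝ) ≤ 2 ^ d := by exact_mod_cast (Nat.lt_two_pow_self (n := d)).le
    have h3 : (2 : ℝ) ^ d ≤ L ^ d := pow_le_pow_left₀ two_pos.le hL2 d
    have h4 : L ^ d ≤ Real.sqrt L * L ^ d := le_mul_of_one_le_left (by positivity) hsL
    linarith
  have hrX : r * L ^ d ≤ Real.sqrt d * X := by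
    rw [hr, Real.sqrt_mul d.cast_nonneg, mul_assoc]
    exact mul_le_mul_of_nonneg_left hsqrt (Real.sqrt_nonneg _)
  have hdd : (d : ℝ) ≤ Real.sqrt d * X := by
    have := mul_le_mul_of_nonneg_left hdX (Real.sqrt_nonneg d)
    rwa [Real.mul_self_sqrt d.cast_nonneg] at this
  have hpos : 0 ≤ Real.sqrt d * X := d.cast_nonneg.trans hdd
  nlinarith

/-- Choose `u_0` to hit the first target, then each `u_i` to steer from one target to the next. -/
theorem drivenPoints_surjective {G : Type*} {s n : ℕ} {φ : G → UnitCube s → G}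
    (hφ : AnywhereToAnywhere φ) {ψ : UnitCube s → G} (hψ : Function.Surjective ψ) :
    Function.Surjective fun u : Fin n → UnitCube s => drivenPoints φ ψ u := by
  intro f
  choose v hv using hψ
  choose w hw using hφ
  refine ⟨fun i => if h : i.1 = 0 then v (f i) else w (f ⟨i.1 - 1, by omega⟩) (f i), ?_⟩
  funext ⟨i, hi⟩
  simp only [drivenPoints]
  induction i with
  | zero => simp [drivenState, hv]
  | succ i ih =>
    rw [drivenState, ih (by omega)]
    simp [hw]

theorem mainTheorem7 {d s : ℕ} (G : Set (Fin d → ℝ)) (hGb : Bornology.IsBounded G)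
    (hGm : MeasurableSet G) (π : Measure G) [IsProbabilityMeasure π]
    (K : Kernel G G) [IsMarkovKernel K]
    (φ : G → UnitCube s → G) (hφ : IsUpdateFunction K φ) (hφ' : AnywhereToAnywhere φ)
    (ψ : UnitCube s → G) (hψ : Function.Surjective ψ) (n : ℕ) (hn : 1 ≤ n) :
    ∃ u : Fin n → UnitCube s,
      starDiscrepancy (anchoredBoxes G) π (drivenPoints φ ψ u) ≤
        63 * Real.sqrt d * ((2 + Real.logb 2 n) ^ ((3 * (d : ℝ) + 1) / 2) / n) := by
  classical
  have hn0 : (0 : ℝ) < n := by exact_mod_cast hn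
  suffices h : ∃ f : Fin n → G, ∀ y : Fin d → ℝ,
      |((Finset.univ.filter fun i => ∀ j, (f i : Fin d → ℝ) j < y j).card : ℝ) -
        n * π.real {g : G | ∀ j, (g : Fin d → ℝ) j < y j}| ≤
        63 * Real.sqrt d * (2 + Real.logb 2 n) ^ ((3 * (d : ℝ) + 1) / 2) by
    obtain ⟨f, hf⟩ := h
    obtain ⟨u, hu⟩ := drivenPoints_surjective hφ' hψ f
    refine ⟨u, ?_⟩
    have hne : Nonempty (anchoredBoxes G) := ⟨⟨_, 0, rfl⟩⟩
    refine ciSup_le ?_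
    rintro ⟨_, y, rfl⟩
    rw [← mul_div_assoc, le_div_iff₀ hn0]
    nth_rewrite 2 [← abs_of_pos hn0]
    rw [← abs_mul]
    refine le_trans (le_of_eq ?_) (hf y)
    congr 1
    rw [sub_mul, one_div, mul_right_comm, inv_mul_cancel₀ hn0.ne', one_mul, mul_comm (π.real _),
      Finset.card_filter, ← hu]
    push_cast
    simp only [Set.indicator_apply, Set.mem_ofPred_eq]
  -- For `d = 0` the bound is `0`, and the only box is all of `G`.
  rcases Nat.eq_zero_or_pos d with rfl | hd
  · obtain ⟨g⟩ := nonempty_of_isProbabilityMeasure π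
    refine ⟨fun _ => g, fun y => ?_⟩
    simp
  · have hL : 2 ≤ 2 + Real.logb 2 n :=
      le_add_of_nonneg_right (Real.logb_nonneg one_lt_two (by exact_mod_cast hn))
    have hd' : (0 : ℝ) < d := by exact_mod_cast hd
    obtain ⟨f, hf⟩ := exists_points_anchoredBox_error_le π n
      (Real.sqrt_pos.2 (mul_pos hd' (two_pos.trans_le hL)))
    exact ⟨f, fun y => (hf y).trans (two_mul_gridError_add_le hd hn)⟩
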